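/- **Notation.** For a complex matrix $M$ let $M^*$, $\mathcal R(M)$ and $M^\dagger$ be its conjugate transpose, range and Moore–Penrose inverse, and let $P_{\mathcal T}$ be the orthogonal projector onto a subspace $\mathcal T$. For a square matrix $B$, $\mathrm{Ind}(B)$ is the least $k\ge 0$ with $\mathrm{rank}(B^k)=\mathrm{rank}(B^{k+1})$, and: * $B^D$ is the Drazin inverse: the unique $X$ with $BX=XB$, $XBX=X$, $XB^{d+1}=B^d$, $d=\mathrm{Ind}(B)$; * $B^{\textcircled{\dagger}}$ is the core-EP inverse: the unique $X$ with $XBX=X$, $\mathcal R(X)=\mathcal R(X^*)=\mathcal R(B^{d})$, $d=\mathrm{Ind}(B)$; * $B^{\textcircled{w}_m}$ ($m\ge1$) is the $m$-weak group inverse: the unique $X$ with $BX^2=X$, $BX=(B^{\textcircled{\dagger}})^mB^m$; and $B^{\textcircled{w}}=B^{\textcircled{w}_1}$ is the weak group inverse. Let $A\in\mathbb C^{q\times n}$ and $0\neq W\in\mathbb C^{n\times q}$. Write $A\star B=AWB$, and let $A^{\star l}$ be the $l$-fold $W$-product $A\star\cdots\star A$ ($l\ge1$), with the conventions $A^{\star0}W=I_q$,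 $WA^{\star 0}=I_n$. With $k_A=\max\{\mathrm{Ind}(AW),\mathrm{Ind}(WA)\}$ (and likewise for other matrices in $\mathbb{C}^{q\times n}$ in place of $A$): * the $W$-weighted Drazin inverse of $A$ is the unique $X$ with $AWX=XWA$, $XWAWX=X$, $XW(AW)^{k_A+1}=(AW)^{k_A}$; if $k_A\le1$ it is called the $W$-weighted group inverse $A^{\#,W}$ (which is said not to exist if $k_A>1$); * $A^{\textcircled{\dagger},W}$ is the weighted core-EP inverse: the unique $X$ with $WAWX=P_{\mathcal R((WA)^{k_A})}$ and $\mathcal R(X)\subseteq\mathcal R((AW)^{k_A})$; * $A^{\textcircled{w}_m,W}$ ($m\ge1$) is the $W$-weighted $m$-weak group inverse: the unique $X$ with $AWXWX=X$, $AWX=(A^{\textcircled{\dagger},W})^{\star m}WA^{\star m}$; and $A^{\textcircled{w},W}=A^{\textcircled{w}_1,W}$ is the $W$-weighted weak group inverse; * $A^{\textcircled{w}_m,W,\dagger}=WA^{\textcircled{w}_m,W}WAA^\dagger$ is the $W$-weighted $m$-weak group MP inverse. **Theorem.** Let $A\in\mathbb C^{q\times n}$, $0\ne W\in\mathbb C^{n\times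 q}$, let $m\ge1$ be an integer, and let $k=\max\{\mathrm{Ind}(AW),\mathrm{Ind}(WA)\}$. Then: 1. the $W$-weighted group inverse of $(AW)^mA^{\textcircled{\dagger},W}WA$ exists, and $A^{\textcircled{w}_m,W,\dagger}=W\big((AW)^mA^{\textcircled{\dagger},W}WA\big)^{\#,W}WA^{\star m}A^\dagger$; 2. $A^{\textcircled{w}_m,W,\dagger}=((WA)^D)^{m+1}P_{\mathcal R((WA)^k)}WA^{\star(m+1)}A^\dagger$; 3. $A^{\textcircled{w}_m,W,\dagger}=WA^{\star l}W\big(WA^{\star(l+m+1)}W\big)^\dagger WA^{\star(m+1)}A^\dagger$ for every integer $l\ge k$; 4. $A^{\textcircled{w}_m,W,\dagger}=W\big(WA^{\star(m+1)}WP_{\mathcal R((AW)^k)}\big)^\dagger WA^{\star(m+1)}A^\dagger$; 5. $A^{\textcircled{w}_m,W,\dagger}=WA^{\star(m-1)}W(A^{\star m})^{\textcircled{w},W}WAA^\dagger$; 6. $A^{\textcircled{w}_m,W,\dagger}=((WA)^{\textcircled{w}})^mWA^{\star m}A^\dagger$; 7. $A^{\textcircled{w}_m,W,\dagger}=(WA)^{\textcircled{w}_m}WAA^\dagger$.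 -/

import Mathlib

open scoped Matrix

namespace GenInv

noncomputable section

/-- The range (column space) of a complex matrix, inside the Euclidean (inner product) space. -/
def range {p r : ℕ} (M : Matrix (Fin p) (Fin r) ℂ) : Submodule ℂ (EuclideanSpace ℂ (Fin p)) :=
  LinearMap.range (Matrix.toEuclideanLin M)

/-- The matrix of the orthogonal projector onto a subspace. -/
def orthProj {p : ℕ} (T : Submodule ℂ (EuclideanSpace ℂ (Fin p))) : Matrix (Fin p) (Fin p) ℂ :=
  Matrix.toEuclideanLin.symm (T.starProjection : EuclideanSpace ℂ (Fin p) →ₗ[ℂ] _)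

/-- The index of a square matrix: the least `k ≥ 0` with `rank (A ^ k) = rank (A ^ (k + 1))`. -/
def ind {p : ℕ} (A : Matrix (Fin p) (Fin p) ℂ) : ℕ :=
  sInf {k | (A ^ k).rank = (A ^ (k + 1)).rank}

/-- The number `max (Ind (A W)) (Ind (W A))`. -/
def wInd {q n : ℕ} (W : Matrix (Fin n) (Fin q) ℂ) (A : Matrix (Fin q) (Fin n) ℂ) : ℕ :=
  max (ind (A * W)) (ind (W * A))

/-- The `l`-fold `W`-product `A ⋆ A ⋆ ⋯ ⋆ A`, where `A ⋆ B = A W B`, for `l ≥ 1`.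
(There is no zeroth power by itself, the value at `l = 0` is a dummy.) -/
def wPow {q n : ℕ} (W : Matrix (Fin n) (Fin q) ℂ) (A : Matrix (Fin q) (Fin n) ℂ) :
    ℕ → Matrix (Fin q) (Fin n) ℂ
  | 0 => 0
  | 1 => A
  | l + 2 => wPow W A (l + 1) * W * A

/-- The expression `W A^{⋆ l}`, with the convention `W A^{⋆ 0} = I`. -/
def mulWPow {q n : ℕ} (W : Matrix (Fin n) (Fin q) ℂ) (A : Matrix (Fin q) (Fin n) ℂ) :
    ℕ → Matrix (Fin n) (Fin n) ℂ
  | 0 => 1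
  | l + 1 => W * wPow W A (l + 1)

/-! Each generalized inverse below is the solution of its defining system. Existence and
uniqueness are proved further down. -/

/-- The four Penrose equations. -/
structure IsMoorePenrose {q n : ℕ} (A : Matrix (Fin q) (Fin n) ℂ)
    (X : Matrix (Fin n) (Fin q) ℂ) : Prop where
  mul_mul_left : A * X * A = A
  mul_mul_right : X * A * X = X
  left_hermitian : (A * X)ᴴ = A * X
  right_hermitian : (X * A)ᴴ = X * A

/-- The Moore–Penrose inverse. -/
def moorePenrose {q n : ℕ} (A : Matrix (Fin q) (Fin n) ℂ) : Matrix (Fin n) (Fin q) ℂ :=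
  Classical.epsilon (IsMoorePenrose A)

/-- The Drazin equations. -/
structure IsDrazin {p : ℕ} (A X : Matrix (Fin p) (Fin p) ℂ) : Prop where
  comm : A * X = X * A
  outer : X * A * X = X
  pow : X * A ^ (ind A + 1) = A ^ ind A

/-- The Drazin inverse. -/
def drazin {p : ℕ} (A : Matrix (Fin p) (Fin p) ℂ) : Matrix (Fin p) (Fin p) ℂ :=
  Classical.epsilon (IsDrazin A)

/-- The equations of the `W`-weighted Drazin inverse. -/
structure IsWDrazin {q n : ℕ} (W : Matrix (Fin n) (Fin q) ℂ)
    (A X : Matrix (Fin q) (Fin n) ℂ) : Prop where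
  comm : A * W * X = X * W * A
  outer : X * W * A * W * X = X
  pow : X * W * (A * W) ^ (wInd W A + 1) = (A * W) ^ wInd W A

/-- The `W`-weighted group inverse: the `W`-weighted Drazin inverse in the case
`max (Ind (A W)) (Ind (W A)) ≤ 1`; in the other case there is none. -/
structure IsWGroup {q n : ℕ} (W : Matrix (Fin n) (Fin q) ℂ)
    (A X : Matrix (Fin q) (Fin n) ℂ) : Prop where
  ind_le : wInd W A ≤ 1
  isWDrazin : IsWDrazin W A X

/-- The `W`-weighted group inverse (meaningful if it exists). -/
def wGroup {q n : ℕ} (W : Matrix (Fin n) (Fin q) ℂ) (A : Matrix (Fin q) (Fin n) ℂ) :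
    Matrix (Fin q) (Fin n) ℂ :=
  Classical.epsilon (IsWGroup W A)

/-- The conditions defining the core-EP inverse. -/
structure IsCoreEP {p : ℕ} (A X : Matrix (Fin p) (Fin p) ℂ) : Prop where
  outer : X * A * X = X
  range_eq : range X = range (A ^ ind A)
  range_conj_eq : range Xᴴ = range (A ^ ind A)

/-- The core-EP inverse. -/
def coreEP {p : ℕ} (A : Matrix (Fin p) (Fin p) ℂ) : Matrix (Fin p) (Fin p) ℂ :=
  Classical.epsilon (IsCoreEP A)

/-- The conditions defining the weighted core-EP inverse. -/
structure IsWCoreEP {q n : ℕ} (W : Matrix (Fin n) (Fin q) ℂ)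
    (A X : Matrix (Fin q) (Fin n) ℂ) : Prop where
  proj : W * A * W * X = orthProj (range ((W * A) ^ wInd W A))
  range_le : range X ≤ range ((A * W) ^ wInd W A)

/-- The weighted core-EP inverse. -/
def wCoreEP {q n : ℕ} (W : Matrix (Fin n) (Fin q) ℂ) (A : Matrix (Fin q) (Fin n) ℂ) :
    Matrix (Fin q) (Fin n) ℂ :=
  Classical.epsilon (IsWCoreEP W A)

/-- The system defining the weak group inverse. -/
structure IsWeakGroup {p : ℕ} (A X : Matrix (Fin p) (Fin p) ℂ) : Prop where
  mul_sq : A * X ^ 2 = X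
  mul_eq : A * X = coreEP A * A

/-- The weak group inverse. -/
def weakGroup {p : ℕ} (A : Matrix (Fin p) (Fin p) ℂ) : Matrix (Fin p) (Fin p) ℂ :=
  Classical.epsilon (IsWeakGroup A)

/-- The system defining the `m`-weak group inverse, `m ≥ 1`. -/
structure IsMWeakGroup {p : ℕ} (m : ℕ) (A X : Matrix (Fin p) (Fin p) ℂ) : Prop where
  mul_sq : A * X ^ 2 = X
  mul_eq : A * X = coreEP A ^ m * A ^ m

/-- The `m`-weak group inverse, `m ≥ 1`. -/
def mWeakGroup {p : ℕ} (m : ℕ) (A : Matrix (Fin p) (Fin p) ℂ) : Matrix (Fin p) (Fin p) ℂ :=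
  Classical.epsilon (IsMWeakGroup m A)

/-- The system defining the `W`-weighted weak group inverse. -/
structure IsWWeakGroup {q n : ℕ} (W : Matrix (Fin n) (Fin q) ℂ)
    (A X : Matrix (Fin q) (Fin n) ℂ) : Prop where
  mul_sq : A * W * X * W * X = X
  mul_eq : A * W * X = wCoreEP W A * W * A

/-- The `W`-weighted weak group inverse. -/
def wWeakGroup {q n : ℕ} (W : Matrix (Fin n) (Fin q) ℂ) (A : Matrix (Fin q) (Fin n) ℂ) :
    Matrix (Fin q) (Fin n) ℂ :=
  Classical.epsilon (IsWWeakGroup W A)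

/-- The system defining the `W`-weighted `m`-weak group inverse, `m ≥ 1`. -/
structure IsWMWeakGroup {q n : ℕ} (m : ℕ) (W : Matrix (Fin n) (Fin q) ℂ)
    (A X : Matrix (Fin q) (Fin n) ℂ) : Prop where
  mul_sq : A * W * X * W * X = X
  mul_eq : A * W * X = wPow W (wCoreEP W A) m * W * wPow W A m

/-- The `W`-weighted `m`-weak group inverse, `m ≥ 1`. -/
def wMWeakGroup {q n : ℕ} (m : ℕ) (W : Matrix (Fin n) (Fin q) ℂ)
    (A : Matrix (Fin q) (Fin n) ℂ) : Matrix (Fin q) (Fin n) ℂ :=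
  Classical.epsilon (IsWMWeakGroup m W A)

/-- The `W`-weighted `m`-weak group MP inverse. -/
def wmWGMP {q n : ℕ} (m : ℕ) (W : Matrix (Fin n) (Fin q) ℂ)
    (A : Matrix (Fin q) (Fin n) ℂ) : Matrix (Fin n) (Fin q) ℂ :=
  W * wMWeakGroup m W A * W * A * moorePenrose A

/-! Existence and uniqueness of the solutions of these systems (for the `m`-weak inverses when
`m ≥ 1`, for the `W`-weighted group inverse when `max (Ind (A W)) (Ind (W A)) ≤ 1`). -/

theorem epsilon_eq {α : Type*} [Nonempty α] {P : α → Prop} (h : ∃! x, P x) {x : α} (hx : P x) :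
    Classical.epsilon P = x :=
  h.unique (Classical.epsilon_spec h.exists) hx

theorem range_le_iff {p r s : ℕ} (M : Matrix (Fin p) (Fin r) ℂ) (N : Matrix (Fin p) (Fin s) ℂ) :
    range M ≤ range N ↔ ∃ Z : Matrix (Fin s) (Fin r) ℂ, M = N * Z := by
  constructor
  · intro h
    have h1 : ∀ j, ∃ z : Fin s → ℂ, N *ᵥ z = M *ᵥ (Pi.single j 1) := by
      intro j
      have : Matrix.toEuclideanLin M (WithLp.toLp 2 (Pi.single j 1)) ∈ range N :=
        h (LinearMap.mem_range_self _ _)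
      obtain ⟨z, hz⟩ := this
      refine ⟨WithLp.ofLp z, ?_⟩
      simpa using congrArg WithLp.ofLp hz
    choose z hz using h1
    refine ⟨Matrix.of fun i j => z j i, ?_⟩
    ext i j
    have := congrFun (hz j) i
    simp only [Matrix.mulVec_single_one, Matrix.col_apply] at this
    rw [← this]
    rfl
  · rintro ⟨Z, rfl⟩ x ⟨v, rfl⟩
    exact ⟨Matrix.toEuclideanLin Z v, by ext i; simp⟩

theorem range_eq_of {p r s : ℕ} {M : Matrix (Fin p) (Fin r) ℂ} {N : Matrix (Fin p) (Fin s) ℂ}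
    {Z : Matrix (Fin s) (Fin r) ℂ} {Z' : Matrix (Fin r) (Fin s) ℂ}
    (h : M = N * Z) (h' : N = M * Z') : range M = range N :=
  le_antisymm ((range_le_iff M N).2 ⟨Z, h⟩) ((range_le_iff N M).2 ⟨Z', h'⟩)

theorem eq_orthProj {p r : ℕ} {P : Matrix (Fin p) (Fin p) ℂ} {M : Matrix (Fin p) (Fin r) ℂ}
    (h1 : P * P = P) (h2 : Pᴴ = P) (h3 : range P = range M) : P = orthProj (range M) := by
  have h4 : (Matrix.toEuclideanLin P).IsSymmetricProjection := by
    refine ⟨?_, Matrix.isSymmetric_toEuclideanLin_iff.2 h2⟩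
    refine LinearMap.ext fun v => ?_
    ext i
    simp [Matrix.mulVec_mulVec, h1]
  obtain ⟨_, h5⟩ := LinearMap.isSymmetricProjection_iff_eq_coe_starProjection_range.1 h4
  have h6 : (range P).starProjection.toLinearMap = Matrix.toEuclideanLin P := h5.symm
  rw [orthProj, ← h3, h6, LinearEquiv.symm_apply_apply]

theorem rank_eq_finrank {p r : ℕ} (M : Matrix (Fin p) (Fin r) ℂ) :
    M.rank = Module.finrank ℂ (range M) := by
  rw [Matrix.rank_eq_finrank_range_toLin M (EuclideanSpace.basisFun _ ℂ).toBasis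
    (EuclideanSpace.basisFun _ ℂ).toBasis, ← Matrix.toEuclideanLin_eq_toLin_orthonormal]
  rfl

theorem ind_spec {p : ℕ} (A : Matrix (Fin p) (Fin p) ℂ) :
    ∃ Z : Matrix (Fin p) (Fin p) ℂ, A ^ ind A = A ^ (ind A + 1) * Z := by
  have hne : {k | (A ^ k).rank = (A ^ (k + 1)).rank}.Nonempty := by
    by_contra hcon
    have hlt : ∀ k, (A ^ (k + 1)).rank < (A ^ k).rank := by
      intro k
      refine lt_of_le_of_ne ?_ ?_
      · rw [pow_succ]; exact Matrix.rank_mul_le_left _ _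
      · intro h; exact hcon ⟨k, h.symm⟩
    have hb : ∀ k, (A ^ k).rank + k ≤ (A ^ 0).rank := by
      intro k
      induction k with
      | zero => simp
      | succ k ih => have := hlt k; omega
    have := hb ((A ^ 0).rank + 1)
    omega
  have h := Nat.sInf_mem hne
  change (A ^ ind A).rank = (A ^ (ind A + 1)).rank at h
  rw [← range_le_iff]
  have hle : range (A ^ (ind A + 1)) ≤ range (A ^ ind A) :=
    (range_le_iff _ _).2 ⟨A, pow_succ _ _⟩
  rw [rank_eq_finrank, rank_eq_finrank] at h
  exact (Submodule.eq_of_le_of_finrank_eq hle h.symm).ge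

theorem ind_spec_add {p : ℕ} (A : Matrix (Fin p) (Fin p) ℂ) (j : ℕ) :
    ∃ Z : Matrix (Fin p) (Fin p) ℂ, A ^ ind A = A ^ (ind A + j) * Z := by
  induction j with
  | zero => exact ⟨1, by simp⟩
  | succ j ih =>
    obtain ⟨Z, hZ⟩ := ih
    obtain ⟨Y, hY⟩ := ind_spec A
    refine ⟨Y * Z, ?_⟩
    calc A ^ ind A = A ^ j * A ^ ind A * Z := by rw [← pow_add, add_comm j]; exact hZ
      _ = A ^ j * (A ^ (ind A + 1) * Y) * Z := by rw [← hY]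
      _ = _ := by rw [← mul_assoc, ← pow_add, mul_assoc]; congr 2; omega

theorem range_pow_eq {p : ℕ} (A : Matrix (Fin p) (Fin p) ℂ) {k : ℕ} (hk : ind A ≤ k) :
    range (A ^ k) = range (A ^ ind A) := by
  obtain ⟨j, rfl⟩ := Nat.exists_eq_add_of_le hk
  obtain ⟨Z, hZ⟩ := ind_spec_add A j
  exact range_eq_of (pow_add A _ _) hZ

open scoped ComplexOrder in
theorem exists_moorePenrose {q n : ℕ} (A : Matrix (Fin q) (Fin n) ℂ) :
    ∃ X, IsMoorePenrose A X := by
  have hH : (Aᴴ * A).IsHermitian := Matrix.isHermitian_conjTranspose_mul_self A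
  obtain ⟨G, hG1, hG2, hG3, hG4⟩ : ∃ G : Matrix (Fin n) (Fin n) ℂ,
      (Aᴴ * A) * (G * (Aᴴ * A)) = Aᴴ * A ∧
      G * (Aᴴ * A) * G = G ∧ Gᴴ = G ∧ (G * (Aᴴ * A))ᴴ = G * (Aᴴ * A) := by
    have hs := hH.spectral_theorem
    rw [Unitary.conjStarAlgAut_apply] at hs
    set U : Matrix (Fin n) (Fin n) ℂ := (hH.eigenvectorUnitary : Matrix (Fin n) (Fin n) ℂ) with hU
    have hUU : star U * U = 1 := Unitary.coe_star_mul_self _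
    set d : Fin n → ℂ := RCLike.ofReal ∘ hH.eigenvalues with hd
    have hsd : star d = d := by ext i; simp [hd]
    have hsi : star (fun i => (d i)⁻¹) = fun i => (d i)⁻¹ := by
      ext i; simp [hd]
    have hdd : ∀ i, d i * ((d i)⁻¹ * d i) = d i := fun i => by
      by_cases h : d i = 0 <;> simp [h]
    have hdi : ∀ i, (d i)⁻¹ * (d i * (d i)⁻¹) = (d i)⁻¹ := fun i => by
      by_cases h : d i = 0 <;> simp [h]
    have key : ∀ X Y : Matrix (Fin n) (Fin n) ℂ,
        (U * X * star U) * (U * Y * star U) = U * (X * Y) * star U := fun X Y => by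
      calc _ = U * X * (star U * U) * Y * star U := by simp only [mul_assoc]
        _ = _ := by rw [hUU]; simp only [mul_assoc, one_mul]
    have keyH : ∀ X : Matrix (Fin n) (Fin n) ℂ,
        (U * X * star U)ᴴ = U * Xᴴ * star U := fun X => by
      simp [Matrix.star_eq_conjTranspose, Matrix.mul_assoc]
    refine ⟨U * Matrix.diagonal (fun i => (d i)⁻¹) * star U, ?_, ?_, ?_, ?_⟩
    · rw [hs, key, key]; simp [hdd]
    · rw [hs, key, key]; simp [mul_assoc, hdi]
    · rw [keyH, Matrix.diagonal_conjTranspose, hsi]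
    · rw [hs, key, keyH, Matrix.conjTranspose_mul, Matrix.diagonal_conjTranspose,
        Matrix.diagonal_conjTranspose, hsd, hsi]
      simp [mul_comm]
  have h1 : A * (G * (Aᴴ * A)) = A := by
    have h0 : Aᴴ * A * (G * (Aᴴ * A) - 1) = 0 := by
      rw [Matrix.mul_sub, hG1, Matrix.mul_one, sub_self]
    have := (Matrix.conjTranspose_mul_self_mul_eq_zero A _).1 h0
    rwa [Matrix.mul_sub, Matrix.mul_one, sub_eq_zero] at this
  refine ⟨G * Aᴴ, ?_, ?_, ?_, ?_⟩
  · simpa only [Matrix.mul_assoc] using h1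
  · conv_rhs => rw [← hG2]
    simp only [Matrix.mul_assoc]
  · simp [hG3, Matrix.mul_assoc]
  · simpa only [Matrix.mul_assoc] using hG4

theorem IsMoorePenrose.unique {q n : ℕ} {A : Matrix (Fin q) (Fin n) ℂ}
    {X Y : Matrix (Fin n) (Fin q) ℂ} (hX : IsMoorePenrose A X) (hY : IsMoorePenrose A Y) :
    X = Y := by
  have h1 : A * X = A * Y := by
    calc A * X = (A * X)ᴴ := hX.left_hermitian.symm
      _ = ((A * Y) * (A * X))ᴴ := by rw [← Matrix.mul_assoc, hY.mul_mul_left]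
      _ = A * X * (A * Y) := by
        rw [Matrix.conjTranspose_mul, hX.left_hermitian, hY.left_hermitian]
      _ = A * Y := by rw [← Matrix.mul_assoc, hX.mul_mul_left]
  have h2 : X * A = Y * A := by
    calc X * A = (X * A)ᴴ := hX.right_hermitian.symm
      _ = ((X * A) * (Y * A))ᴴ := by
        rw [Matrix.mul_assoc, ← Matrix.mul_assoc A Y A, hY.mul_mul_left]
      _ = Y * A * (X * A) := by
        rw [Matrix.conjTranspose_mul, hX.right_hermitian, hY.right_hermitian]
      _ = Y * A := by rw [Matrix.mul_assoc, ← Matrix.mul_assoc A X A, hX.mul_mul_left]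
  calc X = X * A * X := hX.mul_mul_right.symm
    _ = Y * A * X := by rw [h2]
    _ = Y * A * Y := by rw [Matrix.mul_assoc, h1, ← Matrix.mul_assoc]
    _ = Y := hY.mul_mul_right

theorem isMoorePenrose {q n : ℕ} (A : Matrix (Fin q) (Fin n) ℂ) :
    IsMoorePenrose A (moorePenrose A) :=
  Classical.epsilon_spec (exists_moorePenrose A)

theorem drazin_pow_of_le {p : ℕ} {A X : Matrix (Fin p) (Fin p) ℂ} {k l : ℕ}
    (hk : X * A ^ (k + 1) = A ^ k) (hl : k ≤ l) : X * A ^ (l + 1) = A ^ l := by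
  obtain ⟨j, rfl⟩ := Nat.exists_eq_add_of_le hl
  rw [add_right_comm, pow_add, ← mul_assoc, hk, ← pow_add]

theorem IsDrazin.of_pow {p : ℕ} {A X : Matrix (Fin p) (Fin p) ℂ} (hc : A * X = X * A)
    (ho : X * A * X = X) {k : ℕ} (hk : X * A ^ (k + 1) = A ^ k) : IsDrazin A X := by
  refine ⟨hc, ho, ?_⟩
  obtain ⟨Z, hZ⟩ := ind_spec_add A k
  have h1 := drazin_pow_of_le hk (Nat.le_add_left k (ind A))
  calc X * A ^ (ind A + 1) = X * (A * (A ^ (ind A + k) * Z)) := by rw [← hZ, pow_succ']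
    _ = X * A ^ (ind A + k + 1) * Z := by rw [pow_succ']; simp only [mul_assoc]
    _ = A ^ ind A := by rw [h1, ← hZ]

theorem exists_drazin {p : ℕ} (A : Matrix (Fin p) (Fin p) ℂ) : ∃ X, IsDrazin A X := by
  obtain ⟨n, U, hc, hU⟩ : ∃ (n : ℕ) (U : Matrix (Fin p) (Fin p) ℂ),
      Commute A U ∧ A ^ n = U * A ^ (n + 1) := by
    obtain ⟨g, hg, hX⟩ := Polynomial.exists_eq_pow_rootMultiplicity_mul_and_not_dvd
      (minpoly ℂ A) (minpoly.ne_zero (Matrix.isIntegral A)) 0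
    simp only [map_zero, sub_zero] at hg hX
    obtain ⟨u, v, huv⟩ := (Polynomial.irreducible_X.coprime_iff_not_dvd).2 hX
    set r := Polynomial.rootMultiplicity 0 (minpoly ℂ A) with hr
    have h0 : Polynomial.aeval A (Polynomial.X ^ r * g) = 0 := by rw [← hg]; exact minpoly.aeval ℂ A
    refine ⟨r, Polynomial.aeval A u, ?_, ?_⟩
    · have h := (Commute.all (Polynomial.X : Polynomial ℂ) u).map (Polynomial.aeval A)
      rwa [Polynomial.aeval_X] at h
    · have h1 : Polynomial.X ^ r = u * Polynomial.X ^ (r + 1) + v * (Polynomial.X ^ r * g) := by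
        linear_combination (-Polynomial.X ^ r) * huv
      have h2 := congrArg (Polynomial.aeval A) h1
      rw [map_add, map_mul, map_mul, h0, mul_zero, add_zero] at h2
      simpa using h2
  have hj : ∀ j, U ^ j * A ^ (n + j) = A ^ n := by
    intro j
    induction j with
    | zero => simp
    | succ j ih =>
      calc U ^ (j + 1) * A ^ (n + (j + 1)) = U ^ j * (U * A ^ (n + 1)) * A ^ j := by
            rw [pow_succ, show n + (j + 1) = (n + 1) + j by omega, pow_add A (n + 1) j]
            simp only [mul_assoc]
        _ = A ^ n := by rw [← hU, mul_assoc, ← pow_add, ih]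
  have hn1 : U ^ (n + 1) * A ^ (n + (n + 1)) = A ^ n := hj (n + 1)
  have hcom : ∀ i j, A ^ i * U ^ j = U ^ j * A ^ i := fun i j => (hc.pow_pow i j).eq
  refine ⟨U ^ (n + 1) * A ^ n, IsDrazin.of_pow (k := n) ?_ ?_ ?_⟩
  · have := hcom 1 (n + 1)
    rw [pow_one] at this
    rw [← mul_assoc, this, mul_assoc, mul_assoc, ← pow_succ, ← pow_succ']
  · calc U ^ (n + 1) * A ^ n * A * (U ^ (n + 1) * A ^ n)
        = U ^ (n + 1) * (A ^ (n + 1) * U ^ (n + 1)) * A ^ n := by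
          rw [pow_succ A n]; simp only [mul_assoc]
      _ = U ^ (n + 1) * (U ^ (n + 1) * A ^ (n + (n + 1))) := by
          rw [hcom, add_comm n (n + 1), pow_add A (n + 1) n]; simp only [mul_assoc]
      _ = U ^ (n + 1) * A ^ n := by rw [hn1]
  · rw [mul_assoc, ← pow_add, hn1]

theorem IsDrazin.unique {p : ℕ} {A X Y : Matrix (Fin p) (Fin p) ℂ} (hX : IsDrazin A X)
    (hY : IsDrazin A Y) : X = Y := by
  have hp : ∀ {Z : Matrix (Fin p) (Fin p) ℂ}, IsDrazin A Z → ∀ j,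
      Z * A = Z ^ (j + 1) * A ^ (j + 1) ∧ Z * A = A ^ (j + 1) * Z ^ (j + 1) := by
    intro Z hZ j
    have hc : Commute A Z := hZ.comm
    have hi : IsIdempotentElem (Z * A) := by
      rw [IsIdempotentElem, ← mul_assoc, hZ.outer]
    have h1 : Z * A = Z ^ (j + 1) * A ^ (j + 1) := by
      rw [← hc.symm.mul_pow, hi.pow_succ_eq]
    exact ⟨h1, h1.trans (hc.symm.pow_pow _ _).eq⟩
  have hk : ∀ {Z : Matrix (Fin p) (Fin p) ℂ}, IsDrazin A Z →
      Z * A * A ^ (ind A + 1) = A ^ (ind A + 1) := by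
    intro Z hZ
    rw [mul_assoc, ← pow_succ', drazin_pow_of_le hZ.pow (Nat.le_succ _)]
  have hYc : Commute (Y * A) (A ^ (ind A + 1)) := by
    have h : Commute A Y := hY.comm
    exact ((h.symm).mul_left (Commute.refl A)).pow_right _
  have h1 : X * A = X * A * (Y * A) := by
    obtain ⟨h, _⟩ := hp hX (ind A)
    rw [h, mul_assoc, ← hYc.eq, hk hY]
  have h2 : Y * A = X * A * (Y * A) := by
    obtain ⟨_, h⟩ := hp hY (ind A)
    rw [h, ← mul_assoc, hk hX]
  have h3 : X * A = Y * A := h1.trans h2.symm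
  calc X = X * A * X := hX.outer.symm
    _ = Y * (A * X) := by rw [h3, mul_assoc]
    _ = Y * A * Y := by rw [hX.comm, h3, mul_assoc Y A Y, hY.comm]
    _ = Y := hY.outer

theorem isDrazin {p : ℕ} (A : Matrix (Fin p) (Fin p) ℂ) : IsDrazin A (drazin A) :=
  Classical.epsilon_spec (exists_drazin A)

theorem exists_isWDrazin {q n : ℕ} (W : Matrix (Fin n) (Fin q) ℂ)
    (A : Matrix (Fin q) (Fin n) ℂ) : ∃ X, IsWDrazin W A X := by
  have hD := isDrazin (A * W)
  set D := drazin (A * W) with hDd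
  have h1 : A * (W * (D * D)) = D := by
    calc _ = (A * W) * D * D := by simp only [Matrix.mul_assoc]
      _ = D := by rw [hD.comm]; exact hD.outer
  have h2 : D * (D * (A * W)) = D := by
    calc _ = D * (D * (A * W)) := rfl
      _ = D := by rw [← hD.comm, ← Matrix.mul_assoc]; exact hD.outer
  refine ⟨D * D * A, ?_, ?_, ?_⟩
  · calc _ = A * (W * (D * D)) * A := by simp only [Matrix.mul_assoc]
      _ = D * (D * (A * W)) * A := by rw [h1, h2]
      _ = _ := by simp only [Matrix.mul_assoc]
  · calc _ = D * (D * (A * W)) * (A * (W * (D * D))) * A := by simp only [Matrix.mul_assoc]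
      _ = _ := by rw [h1, h2]
  · rw [show D * D * A * W = D * (D * (A * W)) by simp only [Matrix.mul_assoc], h2]
    exact drazin_pow_of_le hD.pow (le_max_left _ _)

theorem IsWDrazin.isDrazin {q n : ℕ} {W : Matrix (Fin n) (Fin q) ℂ}
    {A X : Matrix (Fin q) (Fin n) ℂ} (h : IsWDrazin W A X) : IsDrazin (A * W) (X * W) := by
  refine IsDrazin.of_pow ?_ ?_ h.pow
  · rw [← Matrix.mul_assoc, h.comm, Matrix.mul_assoc (X * W)]
  · rw [← Matrix.mul_assoc, ← Matrix.mul_assoc, h.outer]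

theorem IsWDrazin.unique {q n : ℕ} {W : Matrix (Fin n) (Fin q) ℂ}
    {A X Y : Matrix (Fin q) (Fin n) ℂ} (hX : IsWDrazin W A X) (hY : IsWDrazin W A Y) :
    X = Y := by
  have h := hX.isDrazin.unique hY.isDrazin
  have key : ∀ {Z : Matrix (Fin q) (Fin n) ℂ}, IsWDrazin W A Z → Z = Z * W * (Z * W * A) := by
    intro Z hZ
    rw [← hZ.comm]
    conv_lhs => rw [← hZ.outer]
    simp only [Matrix.mul_assoc]
  rw [key hX, key hY, h]

theorem exists_isWGroup_iff {q n : ℕ} (W : Matrix (Fin n) (Fin q) ℂ)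
    (A : Matrix (Fin q) (Fin n) ℂ) : (∃ X, IsWGroup W A X) ↔ wInd W A ≤ 1 :=
  ⟨fun ⟨_, h⟩ => h.ind_le, fun h => (exists_isWDrazin W A).imp fun _ hX => ⟨h, hX⟩⟩

theorem exists_isCoreEP {p : ℕ} (A : Matrix (Fin p) (Fin p) ℂ) : ∃ X, IsCoreEP A X := by
  have hD := isDrazin A
  set D := drazin A
  set k := ind A with hk
  have hM := isMoorePenrose (A ^ k)
  set Q := moorePenrose (A ^ k)
  have hc : Commute A D := hD.comm
  have hDA : A * (D * A ^ k) = A ^ k := by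
    rw [(hc.symm.pow_right k).eq, ← mul_assoc, ← pow_succ', ← (hc.symm.pow_right _).eq, hD.pow]
  have hADP : A * (D * (A ^ k * Q)) = A ^ k * Q := by
    calc _ = A * (D * A ^ k) * Q := by simp only [mul_assoc]
      _ = _ := by rw [hDA]
  have hPP : A ^ k * Q * (A ^ k * Q) = A ^ k * Q := by
    rw [← mul_assoc, hM.mul_mul_left]
  refine ⟨D * (A ^ k * Q), ?_, ?_, ?_⟩
  · rw [mul_assoc, hADP, mul_assoc, hPP]
  · refine range_eq_of (Z := D * Q) (Z' := A ^ (k + 1)) ?_ ?_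
    · rw [← mul_assoc, (hc.symm.pow_right k).eq, mul_assoc]
    · rw [pow_succ, mul_assoc, mul_assoc, ← mul_assoc Q, ← mul_assoc (A ^ k), ← mul_assoc (A ^ k),
        hM.mul_mul_left, ← pow_succ, hD.pow]
  · refine range_eq_of (Z := Q * Dᴴ) (Z' := Aᴴ * A ^ k) ?_ ?_
    · rw [Matrix.conjTranspose_mul, hM.left_hermitian, Matrix.mul_assoc]
    · rw [← Matrix.mul_assoc, ← Matrix.conjTranspose_mul, hADP, hM.left_hermitian,
        hM.mul_mul_left]

theorem IsCoreEP.pow_form {p : ℕ} {A X : Matrix (Fin p) (Fin p) ℂ} (h : IsCoreEP A X) :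
    X * A * A ^ ind A = A ^ ind A ∧
    A * X = A ^ ind A * moorePenrose (A ^ ind A) ∧ (∃ S, X = A ^ ind A * S) := by
  have hM := isMoorePenrose (A ^ ind A)
  set Q := moorePenrose (A ^ ind A)
  set k := ind A with hk
  obtain ⟨S, hS⟩ := (range_le_iff _ _).1 h.range_eq.le
  obtain ⟨T, hT⟩ := (range_le_iff _ _).1 h.range_eq.ge
  obtain ⟨R, hR⟩ := (range_le_iff _ _).1 h.range_conj_eq.le
  obtain ⟨V, hV⟩ := ind_spec A
  have h1 : X * A * A ^ k = A ^ k := by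
    rw [hT, ← mul_assoc, h.outer]
  have h2 : X * (A ^ k * Q) = X := by
    have h3 : X = Rᴴ * (A ^ k)ᴴ := by
      rw [← Matrix.conjTranspose_mul, ← hR, Matrix.conjTranspose_conjTranspose]
    have h4 : (A ^ k)ᴴ * (A ^ k * Q) = (A ^ k)ᴴ := by
      rw [← hM.left_hermitian, ← Matrix.conjTranspose_mul, hM.mul_mul_left]
    rw [h3, mul_assoc, h4]
  have h5 : A * X * A ^ k = A ^ k := by
    have h6 : A ^ k = A * A ^ k * V := by rw [← pow_succ']; exact hV
    calc A * X * A ^ k = A * X * (A * A ^ k * V) := by rw [← h6]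
      _ = A * (X * A * A ^ k) * V := by simp only [mul_assoc]
      _ = A ^ k := by rw [h1, ← h6]
  refine ⟨h1, ?_, S, hS⟩
  calc A * X = A * (X * (A ^ k * Q)) := by rw [h2]
    _ = A * X * A ^ k * Q := by simp only [mul_assoc]
    _ = _ := by rw [h5]

theorem IsCoreEP.unique {p : ℕ} {A X Y : Matrix (Fin p) (Fin p) ℂ} (hX : IsCoreEP A X)
    (hY : IsCoreEP A Y) : X = Y := by
  obtain ⟨-, h1, S, hS⟩ := hX.pow_form
  obtain ⟨h2, h3, -⟩ := hY.pow_form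
  calc X = Y * A * X := by rw [hS, ← mul_assoc, h2]
    _ = Y * A * Y := by rw [mul_assoc, h1, ← h3, mul_assoc]
    _ = Y := hY.outer

theorem isCoreEP {p : ℕ} (A : Matrix (Fin p) (Fin p) ℂ) : IsCoreEP A (coreEP A) :=
  Classical.epsilon_spec (exists_isCoreEP A)

theorem mul_coreEP_mul_coreEP {p : ℕ} (A : Matrix (Fin p) (Fin p) ℂ) :
    A * (coreEP A * coreEP A) = coreEP A := by
  obtain ⟨-, h1, S, hS⟩ := (isCoreEP A).pow_form
  rw [← mul_assoc, h1]
  conv_lhs => rw [hS]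
  rw [← mul_assoc, (isMoorePenrose (A ^ ind A)).mul_mul_left, ← hS]

theorem pow_mul_coreEP_pow {p : ℕ} (A : Matrix (Fin p) (Fin p) ℂ) (j : ℕ) :
    A ^ j * coreEP A ^ (j + 1) = coreEP A := by
  induction j with
  | zero => simp
  | succ j ih =>
    calc _ = A ^ j * (A * (coreEP A * coreEP A)) * coreEP A ^ j := by
          rw [pow_succ A j, pow_succ' _ (j + 1), pow_succ' _ j]; simp only [mul_assoc]
      _ = _ := by rw [mul_coreEP_mul_coreEP, mul_assoc, ← pow_succ', ih]

theorem mul_coreEP {p : ℕ} (A : Matrix (Fin p) (Fin p) ℂ) {k : ℕ} (hk : ind A ≤ k) :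
    A * coreEP A = orthProj (range (A ^ k)) := by
  obtain ⟨-, h1, -⟩ := (isCoreEP A).pow_form
  have hM := isMoorePenrose (A ^ ind A)
  rw [range_pow_eq A hk, h1]
  refine eq_orthProj ?_ hM.left_hermitian (range_eq_of rfl hM.mul_mul_left.symm)
  rw [← mul_assoc, hM.mul_mul_left]

theorem isWCoreEP_coreEP {q n : ℕ} (W : Matrix (Fin n) (Fin q) ℂ)
    (A : Matrix (Fin q) (Fin n) ℂ) :
    IsWCoreEP W A (A * (coreEP (W * A) * coreEP (W * A))) := by
  constructor
  · rw [← mul_coreEP (W * A) (k := wInd W A) (le_max_right _ _)]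
    conv_rhs => rw [← mul_coreEP_mul_coreEP (W * A)]
    simp only [Matrix.mul_assoc]
  · have hAB : ∀ j, A * (W * A) ^ j = (A * W) ^ j * A := by
      intro j
      induction j with
      | zero => simp
      | succ j ih =>
        rw [pow_succ, ← Matrix.mul_assoc, ih, pow_succ]
        simp only [Matrix.mul_assoc]
    refine (range_le_iff _ _).2 ⟨A * (coreEP (W * A) ^ (wInd W A + 1) * coreEP (W * A)), ?_⟩
    rw [← Matrix.mul_assoc ((A * W) ^ _), ← hAB, Matrix.mul_assoc A,
      ← Matrix.mul_assoc ((W * A) ^ _), pow_mul_coreEP_pow]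

theorem IsWCoreEP.unique {q n : ℕ} {W : Matrix (Fin n) (Fin q) ℂ}
    {A X Y : Matrix (Fin q) (Fin n) ℂ} (hX : IsWCoreEP W A X) (hY : IsWCoreEP W A Y) :
    X = Y := by
  obtain ⟨S, hS⟩ := (range_le_iff _ _).1 hX.range_le
  obtain ⟨T, hT⟩ := (range_le_iff _ _).1 hY.range_le
  have hD := isDrazin (A * W)
  have hk : drazin (A * W) * (A * W) ^ (wInd W A + 1) = (A * W) ^ wInd W A :=
    drazin_pow_of_le hD.pow (le_max_left _ _)
  have hk' : drazin (A * W) * (A * W) ^ (wInd W A + 1 + 1) = (A * W) ^ (wInd W A + 1) :=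
    drazin_pow_of_le hD.pow ((le_max_left _ _).trans (Nat.le_succ _))
  have key : ∀ {Z R : Matrix (Fin q) (Fin n) ℂ}, Z = (A * W) ^ wInd W A * R →
      Z = drazin (A * W) * (drazin (A * W) * (A * (W * A * W * Z))) := by
    intro Z R hZ
    calc Z = drazin (A * W) * (drazin (A * W) * (A * W) ^ (wInd W A + 1 + 1)) * R := by
          rw [hk', hk, ← hZ]
      _ = drazin (A * W) * (drazin (A * W) * (A * (W * A * W * ((A * W) ^ wInd W A * R)))) := by
          rw [pow_succ', pow_succ']; simp only [Matrix.mul_assoc]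
      _ = _ := by rw [← hZ]
  rw [key hS, key hT, hX.proj, hY.proj]

theorem isWCoreEP {q n : ℕ} (W : Matrix (Fin n) (Fin q) ℂ) (A : Matrix (Fin q) (Fin n) ℂ) :
    IsWCoreEP W A (wCoreEP W A) :=
  Classical.epsilon_spec ⟨_, isWCoreEP_coreEP W A⟩

theorem wCoreEP_eq {q n : ℕ} (W : Matrix (Fin n) (Fin q) ℂ) (A : Matrix (Fin q) (Fin n) ℂ) :
    wCoreEP W A = A * (coreEP (W * A) * coreEP (W * A)) :=
  (isWCoreEP W A).unique (isWCoreEP_coreEP W A)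

theorem existsUnique_isMWeakGroup {p m : ℕ} (hm : 1 ≤ m) (A : Matrix (Fin p) (Fin p) ℂ) :
    ∃! X, IsMWeakGroup m A X := by
  obtain ⟨m, rfl⟩ := Nat.exists_eq_add_of_le' hm
  have h1 : A * coreEP A ^ (m + 1 + 1) = coreEP A ^ (m + 1) := by
    rw [pow_succ', pow_succ', ← mul_assoc (coreEP A), ← mul_assoc, mul_coreEP_mul_coreEP]
  refine ⟨coreEP A ^ (m + 1 + 1) * A ^ (m + 1), ⟨?_, ?_⟩, fun X hX => ?_⟩
  · calc _ = A * coreEP A ^ (m + 1 + 1) * (A ^ (m + 1) * coreEP A ^ (m + 1 + 1)) *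
          A ^ (m + 1) := by rw [sq]; simp only [mul_assoc]
      _ = _ := by rw [h1, pow_mul_coreEP_pow, ← pow_succ]
  · rw [← mul_assoc, h1]
  · calc X = A * X * X := by rw [mul_assoc, ← sq, hX.mul_sq]
      _ = coreEP A ^ (m + 1) * (A ^ m * (A * X)) := by
        conv_lhs => rw [hX.mul_eq, pow_succ A]
        simp only [mul_assoc]
      _ = coreEP A ^ (m + 1) * (A ^ m * coreEP A ^ (m + 1)) * A ^ (m + 1) := by
        rw [hX.mul_eq]; simp only [mul_assoc]
      _ = _ := by rw [pow_mul_coreEP_pow, ← pow_succ]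

theorem isWeakGroup_iff {p : ℕ} (A X : Matrix (Fin p) (Fin p) ℂ) :
    IsWeakGroup A X ↔ IsMWeakGroup 1 A X :=
  ⟨fun h => ⟨h.1, by simpa using h.2⟩, fun h => ⟨h.1, by simpa using h.2⟩⟩

theorem wPow_succ {q n : ℕ} (W : Matrix (Fin n) (Fin q) ℂ) (A : Matrix (Fin q) (Fin n) ℂ)
    (l : ℕ) : wPow W A (l + 1) = A * (W * A) ^ l := by
  induction l with
  | zero => simp [wPow]
  | succ l ih => rw [wPow, ih, pow_succ]; simp only [Matrix.mul_assoc]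

theorem wPow_wCoreEP_mul {q n : ℕ} (W : Matrix (Fin n) (Fin q) ℂ) (A : Matrix (Fin q) (Fin n) ℂ)
    (l j : ℕ) : wPow W (wCoreEP W A) (l + 1) * W * wPow W A (j + 1) =
      A * (coreEP (W * A) ^ (l + 2) * (W * A) ^ (j + 1)) := by
  have h : W * wCoreEP W A = coreEP (W * A) := by
    rw [wCoreEP_eq, ← Matrix.mul_assoc, mul_coreEP_mul_coreEP]
  rw [wPow_succ, wPow_succ, h, wCoreEP_eq, pow_succ' (W * A) j, pow_succ', pow_succ']
  simp only [Matrix.mul_assoc]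

/-- The system of the `W`-weighted `m`-weak group inverse has exactly one solution. -/
theorem isWMWeakGroup_iff {q n m : ℕ} (hm : 1 ≤ m) (W : Matrix (Fin n) (Fin q) ℂ)
    (A X : Matrix (Fin q) (Fin n) ℂ) :
    IsWMWeakGroup m W A X ↔ X = wPow W (wCoreEP W A) (m + 1) * W * wPow W A m := by
  obtain ⟨m, rfl⟩ := Nat.exists_eq_add_of_le' hm
  have h1 : W * A * coreEP (W * A) ^ (m + 3) = coreEP (W * A) ^ (m + 2) := by
    rw [pow_succ', pow_succ', ← mul_assoc (coreEP _), ← mul_assoc, mul_coreEP_mul_coreEP,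
      ← pow_succ']
  have hr : ∀ j, A * W * (A * (coreEP (W * A) ^ (m + 3) * (W * A) ^ j)) =
      A * (coreEP (W * A) ^ (m + 2) * (W * A) ^ j) := by
    intro j
    rw [← h1]; simp only [Matrix.mul_assoc]
  constructor
  · intro hX
    have h2 := hX.mul_eq
    rw [wPow_wCoreEP_mul] at h2
    rw [wPow_wCoreEP_mul]
    calc X = A * W * X * W * X := hX.mul_sq.symm
      _ = A * (coreEP (W * A) ^ (m + 2) * ((W * A) ^ m * (W * (A * W * X)))) := by
        conv_lhs => rw [h2, pow_succ (W * A)]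
        simp only [Matrix.mul_assoc]
      _ = A * (coreEP (W * A) ^ (m + 2) * ((W * A) ^ (m + 1) * coreEP (W * A) ^ (m + 2)) *
            (W * A) ^ (m + 1)) := by
        rw [h2, pow_succ (W * A) m]; simp only [Matrix.mul_assoc]
      _ = _ := by rw [pow_mul_coreEP_pow, ← pow_succ]
  · rintro rfl
    refine ⟨?_, ?_⟩
    · rw [wPow_wCoreEP_mul, hr]
      calc _ = A * (coreEP (W * A) ^ (m + 2) * ((W * A) ^ (m + 1 + 1) *
            coreEP (W * A) ^ (m + 1 + 1 + 1)) * (W * A) ^ (m + 1)) := by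
            rw [pow_succ (W * A) (m + 1)]; simp only [Matrix.mul_assoc]
        _ = _ := by rw [pow_mul_coreEP_pow, ← pow_succ]
    · rw [wPow_wCoreEP_mul, wPow_wCoreEP_mul, hr]

theorem isWWeakGroup_iff {q n : ℕ} (W : Matrix (Fin n) (Fin q) ℂ)
    (A X : Matrix (Fin q) (Fin n) ℂ) : IsWWeakGroup W A X ↔ IsWMWeakGroup 1 W A X :=
  ⟨fun h => ⟨h.1, h.2⟩, fun h => ⟨h.1, h.2⟩⟩

end

end GenInv

/-! Put B = WA and let C be the core-EP inverse of B. Everything reduces to the single square matrix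
B, because the weighted core-EP inverse is AC², so that W times it is C, and WA^{⋆l} = B^l. The
left-hand side then takes the normal form C^{m+1}B^{m+1}A† (`wmWGMP_eq`), and each formula amounts
to showing that its factors before A† multiply to C^{m+1}B^{m+1}.

On the core subspace R(B^{Ind B}) the matrix B is invertible, and both C and the Drazin inverse D
invert it there. This gives the cancellation rules B^jC^{j+i+1} = C^{i+1} and C^jB^jC = C. Moreover
BC is the orthogonal projector onto that subspace, so D^{m+1}P = C^{m+1}
(`drazin_pow_succ_mul_orthProj`). The two Moore–Penrose formulas reduce to this identity: their left
factor has the form D^{m+1}NN†, where N has range R(B^{Ind B}). The formulas with weak group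
inverses use closed forms such as C^{m+1}B^m, and (C²B)^m = C^{m+1}B. The one with A^{⋆m} also needs
that the core-EP inverse of B^m is C^m (`coreEP_pow`). For the weighted group inverse an explicit
candidate is verified (`isWGroup_pow_mul_wCoreEP`). -/

namespace GenInv

/-! ### Calculus of powers of a square matrix and its core-EP inverse -/

section CoreEP

variable {p : ℕ} (B : Matrix (Fin p) (Fin p) ℂ)

/-- The columns of C lie in R(B^{Ind B}), which B^j preserves and on which CB acts as the identity.
-/
theorem coreEP_mul_mul_pow_mul_coreEP (j : ℕ) :
    coreEP B * B * (B ^ j * coreEP B) = B ^ j * coreEP B := by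
  obtain ⟨h, -, S, hS⟩ := (isCoreEP B).pow_form
  have h2 : B ^ j * coreEP B = B ^ ind B * (B ^ j * S) := by
    conv_lhs => rw [hS]
    rw [← mul_assoc, ← mul_assoc, ← pow_add, ← pow_add, add_comm]
  rw [h2, ← mul_assoc, h]

theorem coreEP_pow_mul_pow_mul_coreEP (j : ℕ) :
    coreEP B ^ j * (B ^ j * coreEP B) = coreEP B := by
  induction j with
  | zero => simp
  | succ j ih =>
    calc _ = coreEP B ^ j * (coreEP B * B * (B ^ j * coreEP B)) := by
          rw [pow_succ, pow_succ']; simp only [mul_assoc]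
      _ = _ := by rw [coreEP_mul_mul_pow_mul_coreEP, ih]

/-- The main cancellation rule. At least one factor C must survive, since BC itself is only a
projector. -/
theorem pow_mul_coreEP_pow_add (j i : ℕ) :
    B ^ j * coreEP B ^ (j + i + 1) = coreEP B ^ (i + 1) := by
  rw [show j + i + 1 = (j + 1) + i by omega, pow_add, ← mul_assoc, pow_mul_coreEP_pow, pow_succ']

theorem coreEP_mul_mul_coreEP_pow (i : ℕ) :
    coreEP B * B * coreEP B ^ (i + 1) = coreEP B ^ (i + 1) := by
  rw [pow_succ', ← mul_assoc, (isCoreEP B).outer]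

theorem coreEP_pow_mul_mul_coreEP (i : ℕ) :
    coreEP B ^ (i + 1) * (B * coreEP B) = coreEP B ^ (i + 1) := by
  rw [pow_succ, mul_assoc, ← mul_assoc (coreEP B), (isCoreEP B).outer]

/-- D and C both invert B on the core subspace, the range of BC. The extra B on the right makes the
case j = 0 true as well. -/
theorem drazin_pow_mul_mul_coreEP (j : ℕ) :
    drazin B ^ j * (B * coreEP B) = B * coreEP B ^ (j + 1) := by
  have hD := isDrazin B
  have h1 : drazin B * (B * coreEP B) = coreEP B := by
    obtain ⟨-, -, S, hS⟩ := (isCoreEP B).pow_form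
    rw [hS, ← mul_assoc B, ← pow_succ', ← mul_assoc, hD.pow]
  induction j with
  | zero => simp
  | succ j ih =>
    calc _ = drazin B * (B * coreEP B) * coreEP B ^ j := by
          rw [pow_succ', mul_assoc, ih, pow_succ']; simp only [mul_assoc]
      _ = B * (coreEP B * coreEP B) * coreEP B ^ j := by rw [h1, mul_coreEP_mul_coreEP]
      _ = _ := by rw [pow_succ', pow_succ']; simp only [mul_assoc]

theorem drazin_pow_mul_pow_mul {l : ℕ} (hl : ind B ≤ l) (j : ℕ) :
    drazin B ^ j * B ^ (l + j) = B ^ l := by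
  induction j with
  | zero => simp
  | succ j ih =>
    rw [pow_succ, mul_assoc, ← add_assoc, drazin_pow_of_le (isDrazin B).pow (by omega), ih]

theorem drazin_pow_succ_mul_orthProj (j : ℕ) {k : ℕ} (hk : ind B ≤ k) :
    drazin B ^ (j + 1) * orthProj (range (B ^ k)) = coreEP B ^ (j + 1) := by
  rw [← mul_coreEP B hk, drazin_pow_mul_mul_coreEP, pow_succ', pow_succ',
    ← mul_assoc (coreEP B), ← mul_assoc, mul_coreEP_mul_coreEP]

/-- B and B^m share the same core subspace, and powers of C keep both the column space of C and that
of its adjoint. -/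
theorem isCoreEP_pow {m : ℕ} (hm : 1 ≤ m) : IsCoreEP (B ^ m) (coreEP B ^ m) := by
  obtain ⟨m, rfl⟩ := Nat.exists_eq_add_of_le' hm
  have hr : range ((B ^ (m + 1)) ^ ind (B ^ (m + 1))) = range (B ^ ind B) := by
    -- The exponent Ind(B^{m+1}) + Ind(B) is past the index of B^{m+1}, and multiplied by m + 1 it
    -- is past the index of B.
    rw [← range_pow_eq (B ^ (m + 1)) (Nat.le_add_right _ (ind B)), ← pow_mul]
    exact range_pow_eq B (le_trans (Nat.le_add_left _ _) (Nat.le_mul_of_pos_left _ m.succ_pos))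
  have hC := (isCoreEP B).range_eq
  have hP : (B * coreEP B)ᴴ = B * coreEP B := by
    rw [(isCoreEP B).pow_form.2.1, (isMoorePenrose _).left_hermitian]
  refine ⟨?_, ?_, ?_⟩
  · conv_lhs => rw [pow_succ' (coreEP B), mul_assoc, ← pow_succ']
    calc coreEP B ^ (m + 1) * (B ^ (m + 1) * coreEP B ^ (m + 1))
        = coreEP B ^ (m + 1) * (B ^ (m + 1) * coreEP B) * coreEP B ^ m := by
          rw [pow_succ' (coreEP B) m]; simp only [mul_assoc]
      _ = _ := by rw [coreEP_pow_mul_pow_mul_coreEP, ← pow_succ']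
  · rw [hr, ← hC]
    exact range_eq_of (pow_succ' _ _) (coreEP_pow_mul_pow_mul_coreEP B (m + 1)).symm
  · rw [hr, ← hC]
    have h1 : range (B * coreEP B) = range (coreEP B) :=
      range_eq_of (Z := B * (B * coreEP B)) (Z' := coreEP B) (by
        simpa [mul_assoc] using (coreEP_mul_mul_pow_mul_coreEP B 1).symm) (by rw [mul_assoc, mul_coreEP_mul_coreEP])
    rw [← h1]
    -- Take adjoints of C^{m+1} = C^{m+1}(BC) and of BC = B^{m+1}C^{m+1}; BC is Hermitian.
    refine range_eq_of (Z := (coreEP B ^ (m + 1))ᴴ) (Z' := (B ^ (m + 1))ᴴ) ?_ ?_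
    · conv_lhs => rw [← coreEP_pow_mul_mul_coreEP, Matrix.conjTranspose_mul, hP]
    · rw [← Matrix.conjTranspose_mul, ← hP]
      congr 1
      calc B * coreEP B = B * (B ^ m * coreEP B ^ (m + 1)) := by rw [pow_mul_coreEP_pow]
        _ = _ := by rw [← mul_assoc, ← pow_succ']

theorem coreEP_pow {m : ℕ} (hm : 1 ≤ m) : coreEP (B ^ m) = coreEP B ^ m :=
  (isCoreEP _).unique (isCoreEP_pow B hm)

theorem mWeakGroup_eq {m : ℕ} (hm : 1 ≤ m) :
    mWeakGroup m B = coreEP B ^ (m + 1) * B ^ m := by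
  refine epsilon_eq (existsUnique_isMWeakGroup hm B) ?_
  have h1 : B * coreEP B ^ (m + 1) = coreEP B ^ m := by
    obtain ⟨m, rfl⟩ := Nat.exists_eq_add_of_le' hm
    have := pow_mul_coreEP_pow_add B 1 m
    rwa [pow_one, add_comm 1 m] at this
  refine ⟨?_, ?_⟩
  · calc _ = B * coreEP B ^ (m + 1) * (B ^ m * coreEP B ^ (m + 1)) * B ^ m := by
          rw [sq]; simp only [mul_assoc]
      _ = _ := by rw [h1, pow_mul_coreEP_pow, ← pow_succ]
  · rw [← mul_assoc, h1]

theorem weakGroup_eq : weakGroup B = coreEP B ^ 2 * B := by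
  have h : IsWeakGroup B = IsMWeakGroup 1 B := by
    funext X; exact propext (isWeakGroup_iff B X)
  have h2 := mWeakGroup_eq B le_rfl
  rw [mWeakGroup, ← h, pow_one] at h2
  exact h2

/-- The product of copies of C²B telescopes through BC² = C. -/
theorem weakGroup_pow (j : ℕ) : weakGroup B ^ (j + 1) = coreEP B ^ (j + 2) * B := by
  induction j with
  | zero => rw [pow_one, weakGroup_eq]
  | succ j ih =>
    rw [pow_succ, ih, weakGroup_eq]
    calc _ = coreEP B ^ (j + 2) * (B * (coreEP B * coreEP B)) * B := by
          rw [sq]; simp only [mul_assoc]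
      _ = _ := by rw [mul_coreEP_mul_coreEP, ← pow_succ]

end CoreEP

/-! ### Moore–Penrose inverses and orthogonal projectors -/

section MoorePenrose

variable {p r : ℕ}

theorem mul_moorePenrose (M : Matrix (Fin p) (Fin r) ℂ) :
    M * moorePenrose M = orthProj (range M) := by
  have h := isMoorePenrose M
  refine eq_orthProj ?_ h.left_hermitian (range_eq_of rfl h.mul_mul_left.symm)
  rw [← Matrix.mul_assoc, h.mul_mul_left]

theorem exists_orthProj_eq (M : Matrix (Fin p) (Fin r) ℂ) :
    (∃ Z : Matrix (Fin r) (Fin p) ℂ, orthProj (range M) = M * Z) ∧ orthProj (range M) * M = M ∧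
      (orthProj (range M))ᴴ = orthProj (range M) := by
  have h := isMoorePenrose M
  rw [← mul_moorePenrose]
  exact ⟨⟨_, rfl⟩, h.mul_mul_left, h.left_hermitian⟩

/-- The adjoint of H†H = H†HQ is H†H = QH†H, and H† = (H†H)H†. This allows a projector to be
inserted in front of H†. -/
theorem mul_moorePenrose_mul_of_hermitian {H : Matrix (Fin p) (Fin r) ℂ}
    {Q : Matrix (Fin r) (Fin r) ℂ} (hQ : Qᴴ = Q) (hHQ : H * Q = H) :
    Q * moorePenrose H = moorePenrose H := by
  have h := isMoorePenrose H
  have h1 : Q * (moorePenrose H * H) = moorePenrose H * H := by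
    rw [← h.right_hermitian]
    conv_lhs => rw [← hQ]
    rw [← Matrix.conjTranspose_mul, Matrix.mul_assoc, hHQ]
  rw [← h.mul_mul_right, ← Matrix.mul_assoc, h1]

end MoorePenrose

/-- A left factor recovering M from M² forces rank M ≤ rank M². -/
theorem ind_le_one {p : ℕ} {M Y : Matrix (Fin p) (Fin p) ℂ} (h : Y * M ^ 2 = M) :
    ind M ≤ 1 := by
  refine Nat.sInf_le ?_
  change (M ^ 1).rank = (M ^ 2).rank
  refine le_antisymm ?_ ?_
  · conv_lhs => rw [pow_one, ← h]
    exact Matrix.rank_mul_le_right _ _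
  · rw [sq, pow_one]
    exact Matrix.rank_mul_le_left _ _

/-! ### Reduction of the weighted inverses to powers of WA -/

section Weighted

variable {q n : ℕ} (W : Matrix (Fin n) (Fin q) ℂ) (A : Matrix (Fin q) (Fin n) ℂ)

theorem mulWPow_eq (l : ℕ) : mulWPow W A l = (W * A) ^ l := by
  cases l with
  | zero => rfl
  | succ l => rw [mulWPow, wPow_succ, pow_succ', Matrix.mul_assoc]

theorem mul_pow_mul (j : ℕ) : (W * A) ^ j * W = W * (A * W) ^ j := by
  induction j with
  | zero => simp
  | succ j ih =>
    rw [pow_succ', pow_succ', Matrix.mul_assoc, ih]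
    rw [← Matrix.mul_assoc, ← Matrix.mul_assoc]
    rw [Matrix.mul_assoc W A W]

theorem wMWeakGroup_eq {m : ℕ} (hm : 1 ≤ m) :
    wMWeakGroup m W A = A * (coreEP (W * A) ^ (m + 2) * (W * A) ^ m) := by
  have h : wMWeakGroup m W A = wPow W (wCoreEP W A) (m + 1) * W * wPow W A m :=
    epsilon_eq ⟨_, (isWMWeakGroup_iff hm W A _).2 rfl, fun X hX => (isWMWeakGroup_iff hm W A X).1 hX⟩
      ((isWMWeakGroup_iff hm W A _).2 rfl)
  obtain ⟨m, rfl⟩ := Nat.exists_eq_add_of_le' hm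
  rw [h, wPow_wCoreEP_mul]

theorem wWeakGroup_eq : wWeakGroup W A = A * (coreEP (W * A) ^ 3 * (W * A)) := by
  have h : IsWWeakGroup W A = IsWMWeakGroup 1 W A := by
    funext X; exact propext (isWWeakGroup_iff W A X)
  have h2 := wMWeakGroup_eq W A le_rfl
  rw [wMWeakGroup, ← h, pow_one] at h2
  exact h2

/-- The normal form to which every formula is compared: the WA on the left absorbs one core-EP
factor, the WA on the right raises the other exponent. -/
theorem wmWGMP_eq {m : ℕ} (hm : 1 ≤ m) :
    wmWGMP m W A = coreEP (W * A) ^ (m + 1) * (W * A) ^ (m + 1) * moorePenrose A := by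
  rw [wmWGMP, wMWeakGroup_eq W A hm]
  congr 1
  have h := pow_mul_coreEP_pow_add (W * A) 1 m
  rw [pow_one, show 1 + m + 1 = m + 2 by omega] at h
  rw [← h, pow_succ (W * A) m]
  simp only [Matrix.mul_assoc]

/-! ### Left factors with a weighted group inverse, Moore–Penrose inverses and a weak group inverse
-/

theorem range_pow_mul {l : ℕ} (hl : ind (W * A) ≤ l) :
    range ((W * A) ^ l * W) = range ((W * A) ^ ind (W * A)) := by
  refine le_antisymm ?_ ?_
  · rw [← range_pow_eq _ hl]
    exact (range_le_iff _ _).2 ⟨W, rfl⟩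
  · rw [← range_pow_eq _ (hl.trans l.le_succ)]
    -- Since B^{l+1} = (B^lW)A, the range is squeezed between those of B^{l+1} and B^l.
    exact (range_le_iff _ _).2 ⟨A, by rw [pow_succ, Matrix.mul_assoc]⟩

/-- Call the two matrices M and X. Then WM = B^mCB and WX = C^{m+1}B, whose product in either order
is the idempotent CB; this is what suggests X. -/
theorem isWGroup_pow_mul_wCoreEP {m : ℕ} (hm : 1 ≤ m) :
    IsWGroup W ((A * W) ^ m * wCoreEP W A * W * A)
      (A * (coreEP (W * A) ^ (m + 2) * (W * A))) := by
  obtain ⟨m, rfl⟩ := Nat.exists_eq_add_of_le' hm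
  set B := W * A with hB
  set C := coreEP B with hC
  have hWC : W * wCoreEP W A = C := by
    rw [wCoreEP_eq, ← Matrix.mul_assoc, mul_coreEP_mul_coreEP]
  have hM : (A * W) ^ (m + 1) * wCoreEP W A * W * A = A * (B ^ m * C * B) := by
    calc _ = A * W * (A * W) ^ m * wCoreEP W A * B := by
          rw [pow_succ', Matrix.mul_assoc _ W A]
      _ = A * (W * (A * W) ^ m * wCoreEP W A * B) := by simp only [Matrix.mul_assoc]
      _ = A * (B ^ m * (W * wCoreEP W A) * B) := by
          rw [← mul_pow_mul, ← hB]; simp only [Matrix.mul_assoc]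
      _ = _ := by rw [hWC]
  rw [hM]
  set M := A * (B ^ m * C * B) with hMd
  set X := A * (C ^ (m + 1 + 2) * B) with hX
  have hWM : W * M = B ^ (m + 1) * C * B := by
    rw [hMd, ← Matrix.mul_assoc, ← hB, pow_succ']; simp only [Matrix.mul_assoc]
  have hWX : W * X = C ^ (m + 2) * B := by
    have h := pow_mul_coreEP_pow_add B 1 (m + 1)
    rw [pow_one, show 1 + (m + 1) + 1 = m + 1 + 2 by omega] at h
    rw [hX, ← Matrix.mul_assoc, ← hB, ← mul_assoc, h]
  have hMX : M * W * X = A * (C ^ 2 * B) := by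
    rw [Matrix.mul_assoc, hWX, hMd]
    calc _ = A * (B ^ m * (C * B * C ^ (m + 1 + 1)) * B) := by simp only [Matrix.mul_assoc]
      _ = _ := by rw [coreEP_mul_mul_coreEP_pow, pow_mul_coreEP_pow_add B m 1]
  have hXM : X * W * M = A * (C ^ 2 * B) := by
    rw [Matrix.mul_assoc, hWM, hX]
    calc _ = A * (C * (C ^ (m + 2) * (B ^ (m + 2) * C)) * B) := by
          rw [pow_succ' C (m + 2), pow_succ' B (m + 1)]; simp only [Matrix.mul_assoc]
      _ = _ := by rw [coreEP_pow_mul_pow_mul_coreEP, sq]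
  have hXMX : X * W * M * W * X = X := by
    rw [hXM, Matrix.mul_assoc, hWX]
    calc _ = A * (C * (C * B * C ^ (m + 1 + 1)) * B) := by
          rw [sq]; simp only [Matrix.mul_assoc]
      _ = _ := by rw [coreEP_mul_mul_coreEP_pow, ← pow_succ']
  have hXMM : X * W * M * W * M = M := by
    rw [hXM, Matrix.mul_assoc, hWM, hMd]
    calc _ = A * (C * (C * B * (B ^ (m + 1) * C)) * B) := by
          rw [sq]; simp only [Matrix.mul_assoc]
      _ = A * (C * B * (B ^ m * C) * B) := by
          rw [coreEP_mul_mul_pow_mul_coreEP, pow_succ', hC]; simp only [Matrix.mul_assoc]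
      _ = _ := by rw [coreEP_mul_mul_pow_mul_coreEP]
  -- The weighted index involves both MW and WM, so the rank bound is needed on each side.
  have h1 : X * W * (M * W) ^ 2 = M * W := by
    conv_rhs => rw [← hXMM]
    rw [sq]; simp only [Matrix.mul_assoc]
  have h2 : W * X * (W * M) ^ 2 = W * M := by
    conv_rhs => rw [← hXMM]
    rw [sq]; simp only [Matrix.mul_assoc]
  -- The weighted power equation has exponent `wInd`, which may be 0, while `h1` gives exponent 1.
  -- Passing through the ordinary Drazin equations lowers the exponent to the index of MW, from
  -- which it can be raised to `wInd`.
  have hD : IsDrazin (M * W) (X * W) := by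
    refine IsDrazin.of_pow (k := 1) ?_ ?_ (by rw [pow_one]; exact h1)
    · rw [← Matrix.mul_assoc, hMX, ← hXM, Matrix.mul_assoc]
    · conv_rhs => rw [← hXMX]
      simp only [Matrix.mul_assoc]
  exact ⟨max_le (ind_le_one h1) (ind_le_one h2), hMX.trans hXM.symm, hXMX,
    drazin_pow_of_le hD.pow (le_max_left _ _)⟩

theorem IsWGroup.wGroup_eq {W : Matrix (Fin n) (Fin q) ℂ} {M X : Matrix (Fin q) (Fin n) ℂ}
    (h : IsWGroup W M X) : wGroup W M = X :=
  epsilon_eq ⟨X, h, fun _ hY => hY.isWDrazin.unique h.isWDrazin⟩ h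

theorem mul_wGroup_mul_pow {m : ℕ} (hm : 1 ≤ m) :
    W * wGroup W ((A * W) ^ m * wCoreEP W A * W * A) * (W * A) ^ m =
      coreEP (W * A) ^ (m + 1) * (W * A) ^ (m + 1) := by
  have h := pow_mul_coreEP_pow_add (W * A) 1 m
  rw [pow_one, show 1 + m + 1 = m + 2 by omega] at h
  rw [(isWGroup_pow_mul_wCoreEP W A hm).wGroup_eq, ← h, pow_succ' (W * A) m]
  simp only [Matrix.mul_assoc]

/-- With N = B^{l+m+1}W, writing B^l = D^{m+1}B^{l+m+1} turns the left side into D^{m+1}NN†, and NN†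
projects onto the core subspace. -/
theorem pow_mul_moorePenrose_pow_mul (m : ℕ) {l : ℕ} (hl : ind (W * A) ≤ l) :
    (W * A) ^ l * W * moorePenrose ((W * A) ^ (l + m + 1) * W) = coreEP (W * A) ^ (m + 1) := by
  calc _ = drazin (W * A) ^ (m + 1) * ((W * A) ^ (l + m + 1) * W *
        moorePenrose ((W * A) ^ (l + m + 1) * W)) := by
        conv_lhs => rw [← drazin_pow_mul_pow_mul (W * A) hl (m + 1)]
        simp only [Matrix.mul_assoc, add_assoc]
    _ = _ := by
        rw [mul_moorePenrose, range_pow_mul W A (by omega), drazin_pow_succ_mul_orthProj _ _ le_rfl]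

/-- With Q the projector and H = B^{m+1}WQ, the identities H† = QH† and WQ = D^{m+1}H give WH† =
D^{m+1}HH†. -/
theorem mul_moorePenrose_mul_orthProj (m : ℕ) {k : ℕ} (hk : ind (W * A) ≤ k) :
    W * moorePenrose ((W * A) ^ (m + 1) * W * orthProj (range ((A * W) ^ k))) =
      coreEP (W * A) ^ (m + 1) := by
  obtain ⟨⟨Z, hZ⟩, hQN, hQ⟩ := exists_orthProj_eq ((A * W) ^ k)
  set Q := orthProj (range ((A * W) ^ k))
  have hQQ : Q * Q = Q := by
    nth_rw 2 [hZ]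
    rw [← Matrix.mul_assoc, hQN, ← hZ]
  set H := (W * A) ^ (m + 1) * W * Q with hH
  have hpow : (W * A) ^ (m + 1) * W * (A * W) ^ k = (W * A) ^ (k + (m + 1)) * W := by
    rw [Matrix.mul_assoc, ← mul_pow_mul, ← Matrix.mul_assoc, ← pow_add, add_comm]
  -- W maps R((AW)^k) into R(B^k), where D^{m+1} undoes B^{m+1}.
  have hWQ : W * Q = drazin (W * A) ^ (m + 1) * H := by
    calc W * Q = (W * A) ^ k * W * Z := by rw [hZ, mul_pow_mul, Matrix.mul_assoc]
      _ = drazin (W * A) ^ (m + 1) * ((W * A) ^ (m + 1) * W * (A * W) ^ k) * Z := by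
          rw [hpow, ← Matrix.mul_assoc, drazin_pow_mul_pow_mul _ hk]
      _ = _ := by rw [hH, hZ]; simp only [Matrix.mul_assoc]
  have hr : range H = range ((W * A) ^ (k + (m + 1)) * W) := by
    rw [← hpow]
    refine range_eq_of (Z := Z) (Z' := (A * W) ^ k) ?_ ?_
    · rw [hH, hZ]; simp only [Matrix.mul_assoc]
    · rw [hH, Matrix.mul_assoc _ Q, hQN]
  have hHQ : H * Q = H := by rw [hH, Matrix.mul_assoc, hQQ]
  rw [← mul_moorePenrose_mul_of_hermitian hQ hHQ, ← Matrix.mul_assoc, hWQ, Matrix.mul_assoc,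
    mul_moorePenrose, hr, range_pow_mul W A (by omega), drazin_pow_succ_mul_orthProj _ _ le_rfl]

theorem pow_mul_wWeakGroup_wPow {m : ℕ} (hm : 1 ≤ m) :
    (W * A) ^ (m - 1) * W * wWeakGroup W (wPow W A m) * W * A =
      coreEP (W * A) ^ (m + 1) * (W * A) ^ (m + 1) := by
  have hW : W * wPow W A m = (W * A) ^ m := by
    obtain ⟨m, rfl⟩ := Nat.exists_eq_add_of_le' hm
    rw [wPow_succ, ← Matrix.mul_assoc, pow_succ']
  -- The weak group inverse of A^{⋆m} contributes (C^m)³. The factors B^{m-1} and WA^{⋆m} = B^m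
  -- absorb 2m − 1 of these 3m copies of C, leaving m + 1.
  have h := pow_mul_coreEP_pow_add (W * A) (m - 1 + m) m
  rw [show m - 1 + m + m + 1 = m * 3 by omega] at h
  rw [wWeakGroup_eq, hW, coreEP_pow _ hm, ← pow_mul, ← h, pow_add, pow_succ (W * A) m]
  conv_rhs => rw [← hW]
  conv_lhs => rw [← hW]
  simp only [Matrix.mul_assoc]

end Weighted

end GenInv

theorem mainTheorem5 (q n : ℕ) (A : Matrix (Fin q) (Fin n) ℂ) (W : Matrix (Fin n) (Fin q) ℂ)
    (hW : W ≠ 0) (m : ℕ) (hm : 1 ≤ m) (k : ℕ)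
    (hk : k = max (GenInv.ind (A * W)) (GenInv.ind (W * A))) :
    ((∃ X, GenInv.IsWGroup W ((A * W) ^ m * GenInv.wCoreEP W A * W * A) X) ∧
      GenInv.wmWGMP m W A =
        W * GenInv.wGroup W ((A * W) ^ m * GenInv.wCoreEP W A * W * A) *
          GenInv.mulWPow W A m * GenInv.moorePenrose A) ∧
    GenInv.wmWGMP m W A =
      GenInv.drazin (W * A) ^ (m + 1) * GenInv.orthProj (GenInv.range ((W * A) ^ k)) *
        GenInv.mulWPow W A (m + 1) * GenInv.moorePenrose A ∧
    (∀ l : ℕ, k ≤ l →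
      GenInv.wmWGMP m W A =
        GenInv.mulWPow W A l * W *
          GenInv.moorePenrose (GenInv.mulWPow W A (l + m + 1) * W) *
          GenInv.mulWPow W A (m + 1) * GenInv.moorePenrose A) ∧
    GenInv.wmWGMP m W A =
      W * GenInv.moorePenrose (GenInv.mulWPow W A (m + 1) * W *
          GenInv.orthProj (GenInv.range ((A * W) ^ k))) *
        GenInv.mulWPow W A (m + 1) * GenInv.moorePenrose A ∧
    GenInv.wmWGMP m W A =
      GenInv.mulWPow W A (m - 1) * W * GenInv.wWeakGroup W (GenInv.wPow W A m) *
        W * A * GenInv.moorePenrose A ∧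
    GenInv.wmWGMP m W A =
      GenInv.weakGroup (W * A) ^ m * GenInv.mulWPow W A m * GenInv.moorePenrose A ∧
    GenInv.wmWGMP m W A =
      GenInv.mWeakGroup m (W * A) * W * A * GenInv.moorePenrose A := by
  have hk' : GenInv.ind (W * A) ≤ k := hk ▸ le_max_right _ _
  simp only [GenInv.mulWPow_eq]
  rw [GenInv.wmWGMP_eq W A hm]
  refine ⟨⟨⟨_, GenInv.isWGroup_pow_mul_wCoreEP W A hm⟩, ?_⟩, ?_, fun l hl => ?_, ?_, ?_, ?_, ?_⟩
  · rw [GenInv.mul_wGroup_mul_pow W A hm]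
  · rw [GenInv.drazin_pow_succ_mul_orthProj _ _ hk']
  · rw [GenInv.pow_mul_moorePenrose_pow_mul W A m (hk'.trans hl)]
  · rw [GenInv.mul_moorePenrose_mul_orthProj W A m hk']
  · rw [GenInv.pow_mul_wWeakGroup_wPow W A hm]
  · obtain ⟨m, rfl⟩ := Nat.exists_eq_add_of_le' hm
    -- The single B left over from the power of the weak group inverse joins the following power of
    -- B.
    rw [GenInv.weakGroup_pow, mul_assoc (_ ^ _), ← pow_succ']
  · rw [GenInv.mWeakGroup_eq _ hm, Matrix.mul_assoc _ W A, mul_assoc (_ ^ _), ← pow_succ]
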